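/- Let $A$ be a commutative ring with unit, let $p=X^n+c_1X^{n-1}+\dots+c_n\in A[X]$ be a monic polynomial of degree $n\ge 0$ (put $c_i=0$ for $i>n$), and let $k\ge 1$. Let $M=XA[X]$, a free $A$-module with basis $\epsilon^i=X^i$ ($i\ge 1$), and let $D=(D_0,D_1,\dots)$ be the sequence of $A$-endomorphisms of the exterior algebra $\bigwedge M$ such that $\alpha\mapsto\sum_{h\ge0}D_h(\alpha)t^h$ is an $A$-algebra homomorphism $\bigwedge M\to(\bigwedge M)[[t]]$ and $D_h\epsilon^i=\epsilon^{i+h}$ for all $h\ge 0$, $i\ge 1$. The $D_h$ commute with each other and preserve $\bigwedge^kM$; let $A[D_1,\dots,D_k]\subseteq \mathrm{End}_A(\bigwedge^kM)$ be the commutative $A$-algebra generated by the restrictions of $D_1,\dots,D_k$ to $\bigwedge^kM$, and let $J_k(p)$ be its ideal $$J_k(p)=\{P(D)\in A[D_1,\dots,D_k]\;:\;P(D)(\epsilon^1\wedge\dots\wedge\epsilon^k)\in \textstyle\bigwedge^{k-1}M\wedge pM\},$$ where $\bigwedge^{k-1}M\wedge pM$ is the $A$-submodule of $\bigwedge^kM$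 spanned by the elements $\alpha\wedge pm$ with $\alpha\in\bigwedge^{k-1}M$, $m\in M$. Define $\widetilde D_m=\widetilde D_m(T_1,\dots,T_k)\in A[T_1,\dots,T_k]$ by $$\sum_{m\ge0}\widetilde D_m t^m=\frac{1}{1-\Delta_1t+\Delta_2t^2-\dots+(-1)^k\Delta_kt^k},\qquad \Delta_h=\det(T_{j+1-i})_{1\le i,j\le h},$$ with $T_0=1$ and $T_j=0$ for $j<0$, and $\widetilde D_m=0$ for $m<0$; and put, for every integer $m$, $$\widetilde D_m(\mathbf T_k,p)=\widetilde D_m+\sum_{i=1}^{m}c_i\widetilde D_{m-i}$$ (the sum is empty for $m\le 0$). Write $\widetilde D_m(\mathbf D_k,p)$ for its value at $T_i=D_i$ ($1\le i\le k$). Then $$J_k(p)=\bigl(\widetilde D_{n-k+1}(\mathbf D_k,p),\dots,\widetilde D_{n}(\mathbf D_k,p)\bigr).$$ The same holds at the level of polynomials: for $P\in A[T_1,\dots,T_k]$, one has $P(D)(\epsilon^1\wedge\dots\wedge\epsilon^k)\in\bigwedge^{k-1}M\wedge pM$ if and only if $P$ lies in the ideal of $A[T_1,\dots,T_k]$ generated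 by $\widetilde D_{n-k+1}(\mathbf T_k,p),\dots,\widetilde D_n(\mathbf T_k,p)$. -/

import Mathlib

open Polynomial

namespace GrassmannAlgebra

section Derivation

variable {A : Type*} [CommRing A] {M : Type*} [AddCommGroup M] [Module A M]

/-- The `A`-linear map `M → (⋀ M)⟦t⟧`, `m ↦ ∑ f_i(m) t^i`, attached to a sequence of endomorphisms
of `M`. -/
noncomputable def genMap (f : ℕ → Module.End A M) : M →ₗ[A] PowerSeries (ExteriorAlgebra A M) where
  toFun m := PowerSeries.mk fun i => ExteriorAlgebra.ι A (f i m)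
  map_add' x y := by
    ext i
    simp
  map_smul' a x := by
    ext i
    simp

theorem genMap_sq (f : ℕ → Module.End A M) (m : M) : genMap f m * genMap f m = 0 := by
  ext h
  rw [PowerSeries.coeff_mul]
  simp only [genMap, LinearMap.coe_mk, AddHom.coe_mk, PowerSeries.coeff_mk, map_zero]
  refine Finset.sum_involution (fun x _ => x.swap) ?_ ?_ ?_ ?_
  · intro x _
    exact ExteriorAlgebra.ι_add_mul_swap _ _
  · intro x _ hne heq
    apply hne
    have : x.2 = x.1 := congrArg Prod.fst heq
    rw [this]
    exact ExteriorAlgebra.ι_sq_zero _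
  · intro x hx
    simpa [add_comm] using hx
  · intro x _
    simp

/-- The derivation `D_t : ⋀ M → (⋀ M)⟦t⟧` (an `A`-algebra homomorphism) extending
`m ↦ ∑ f_i(m) t^i`. -/
noncomputable def derivation (f : ℕ → Module.End A M) :
    ExteriorAlgebra A M →ₐ[A] PowerSeries (ExteriorAlgebra A M) :=
  ExteriorAlgebra.lift A ⟨genMap f, genMap_sq f⟩

/-- The `h`-th coefficient `D_h ∈ End_A(⋀ M)` of `D_t`. -/
noncomputable def derivCoeff (f : ℕ → Module.End A M) (h : ℕ) :
    Module.End A (ExteriorAlgebra A M) where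
  toFun α := PowerSeries.coeff h (derivation f α)
  map_add' x y := by simp
  map_smul' a x := by simp

theorem derivCoeff_ι (f : ℕ → Module.End A M) (h : ℕ) (m : M) :
    derivCoeff f h (ExteriorAlgebra.ι A m) = ExteriorAlgebra.ι A (f h m) := by
  simp [derivCoeff, derivation, genMap]

theorem derivCoeff_algebraMap (f : ℕ → Module.End A M) (h : ℕ) (a : A) :
    derivCoeff f h (algebraMap A _ a) = if h = 0 then algebraMap A _ a else 0 := by
  simp only [derivCoeff, LinearMap.coe_mk, AddHom.coe_mk, AlgHom.commutes]
  rw [PowerSeries.algebraMap_apply, PowerSeries.coeff_C]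

/-- The Leibniz rule of order `h`. -/
theorem derivCoeff_mul (f : ℕ → Module.End A M) (h : ℕ) (α β : ExteriorAlgebra A M) :
    derivCoeff f h (α * β) =
      ∑ x ∈ Finset.HasAntidiagonal.antidiagonal h, derivCoeff f x.1 α * derivCoeff f x.2 β := by
  simp [derivCoeff, PowerSeries.coeff_mul]

theorem derivCoeff_comm (f : ℕ → Module.End A M) (hf : ∀ i j, f i * f j = f j * f i) (i j : ℕ)
    (α : ExteriorAlgebra A M) :
    derivCoeff f i (derivCoeff f j α) = derivCoeff f j (derivCoeff f i α) := by
  induction α using ExteriorAlgebra.induction generalizing i j with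
  | algebraMap a =>
    simp only [derivCoeff_algebraMap]
    split_ifs <;> simp [derivCoeff_algebraMap, *]
  | ι m =>
    simp only [derivCoeff_ι]
    exact congrArg _ (LinearMap.congr_fun (hf i j) m)
  | mul a b ha hb =>
    simp only [derivCoeff_mul, map_sum]
    rw [Finset.sum_comm]
    refine Finset.sum_congr rfl fun x _ => Finset.sum_congr rfl fun y _ => ?_
    rw [ha, hb]
  | add a b ha hb => simp only [map_add, ha, hb]

theorem derivCoeff_mem (f : ℕ → Module.End A M) (k h : ℕ) (α : ExteriorAlgebra A M)
    (hα : α ∈ ⋀[A]^k M) : derivCoeff f h α ∈ ⋀[A]^k M := by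
  induction k generalizing h α with
  | zero =>
    rw [ExteriorAlgebra.exteriorPower, pow_zero] at hα ⊢
    obtain ⟨a, rfl⟩ := Submodule.mem_one.1 hα
    rw [derivCoeff_algebraMap]
    split_ifs
    · exact hα
    · exact zero_mem _
  | succ k ih =>
    rw [ExteriorAlgebra.exteriorPower, pow_succ] at hα ⊢
    induction hα using Submodule.mul_induction_on' with
    | mem_mul_mem a ha b hb =>
      rw [derivCoeff_mul]
      refine sum_mem fun x _ => Submodule.mul_mem_mul (ih _ _ ha) ?_
      obtain ⟨m, rfl⟩ := hb
      rw [derivCoeff_ι]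
      exact ⟨_, rfl⟩
    | add a _ b _ ha hb =>
      rw [map_add]
      exact add_mem ha hb

end Derivation

variable (A : Type*) [CommRing A]

/-- The module `M = X A[X]`, as the ideal of `A[X]` generated by `X`. It is an `A[X]`-module and an
`A`-module. -/
def XMod : Type _ := ↥(Ideal.span {(X : A[X])} : Ideal A[X])

noncomputable instance : AddCommGroup (XMod A) :=
  inferInstanceAs (AddCommGroup ↥(Ideal.span {(X : A[X])} : Ideal A[X]))

noncomputable instance : Module A[X] (XMod A) :=
  inferInstanceAs (Module A[X] ↥(Ideal.span {(X : A[X])} : Ideal A[X]))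

noncomputable instance : Module A (XMod A) :=
  inferInstanceAs (Module A ↥(Ideal.span {(X : A[X])} : Ideal A[X]))

instance : IsScalarTower A A[X] (XMod A) :=
  inferInstanceAs (IsScalarTower A A[X] ↥(Ideal.span {(X : A[X])} : Ideal A[X]))

variable {A} in
/-- Multiplication by a polynomial, as an `A`-endomorphism of `M = X A[X]`. -/
noncomputable def mulEnd (q : A[X]) : Module.End A (XMod A) := Algebra.lsmul A A (XMod A) q

/-- `ε^i = X^i` for `i = 1, 2, …`; here `eps i` is `ε^{i+1} = X^{i+1}`, `i = 0, 1, …`. -/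
noncomputable def eps (i : ℕ) : XMod A :=
  ⟨X ^ (i + 1), Ideal.mem_span_singleton.2 (dvd_pow_self X i.succ_ne_zero)⟩

/-- The canonical derivation `D = (D_0, D_1, …)` of `⋀ M`: on `M` the operator `D_h` is
multiplication by `X^h`, that is `D_h ε^i = ε^{i+h}`. -/
noncomputable def D (h : ℕ) : Module.End A (ExteriorAlgebra A (XMod A)) :=
  derivCoeff (fun i => mulEnd (X ^ i)) h

theorem D_eps (h i : ℕ) :
    D A h (ExteriorAlgebra.ι A (eps A i)) = ExteriorAlgebra.ι A (eps A (i + h)) := by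
  rw [D, derivCoeff_ι]
  congr 1
  apply Subtype.ext
  change (X : A[X]) ^ h * X ^ (i + 1) = X ^ (i + h + 1)
  ring

/-- The restriction of `D_h` to `⋀^k M`. -/
noncomputable def Dk (k h : ℕ) : Module.End A (⋀[A]^k (XMod A)) :=
  (D A h).restrict fun α hα => derivCoeff_mem _ k h α hα

theorem Dk_comm (k i j : ℕ) : Dk A k i * Dk A k j = Dk A k j * Dk A k i := by
  refine LinearMap.ext fun α => Subtype.ext ?_
  refine derivCoeff_comm _ (fun i j => ?_) i j α.1
  rw [mulEnd, mulEnd, ← map_mul, ← map_mul, mul_comm]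

/-- The ring `A[D_1, …, D_k] ⊆ End_A(⋀^k M)`. -/
noncomputable abbrev opRing (k : ℕ) : Subalgebra A (Module.End A (⋀[A]^k (XMod A))) :=
  Algebra.adjoin A (Set.range fun i : Fin k => Dk A k (i + 1))

theorem opRing_comm (k : ℕ) (x y : opRing A k) : x * y = y * x := by
  have := Algebra.isMulCommutative_adjoin A
    (s := Set.range fun i : Fin k => Dk A k (i + 1)) (by
      rintro _ ⟨i, rfl⟩ _ ⟨j, rfl⟩
      exact Dk_comm A k _ _)
  exact mul_comm' x y

noncomputable instance opRingCommRing (k : ℕ) : CommRing (opRing A k) :=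
  { Algebra.semiringToRing A (A := opRing A k) with mul_comm := opRing_comm A k }

/-- The evaluation `P ↦ P(D)` from `A[T_1, …, T_k]` to `A[D_1, …, D_k]`; the variable `T_{i+1}` is
`MvPolynomial.X i`, for `i : Fin k`. -/
noncomputable def evD (k : ℕ) : MvPolynomial (Fin k) A →ₐ[A] opRing A k :=
  MvPolynomial.aeval fun i : Fin k =>
    (⟨Dk A k (i + 1), Algebra.subset_adjoin ⟨i, rfl⟩⟩ : opRing A k)

/-- `ε^1 ∧ … ∧ ε^k ∈ ⋀^k M`. -/
noncomputable def epsTop (k : ℕ) : ⋀[A]^k (XMod A) :=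
  exteriorPower.ιMulti A k fun i : Fin k => eps A i

variable {A}

/-- `⋀^{k-1} M ∧ pM`, as an `A`-submodule of `⋀ M`: the span of all `α ∧ pm` with
`α ∈ ⋀^{k-1} M` and `m ∈ M` (used for `k ≥ 1`). -/
noncomputable def wedgeP (k : ℕ) (p : A[X]) : Submodule A (ExteriorAlgebra A (XMod A)) :=
  (⋀[A]^(k - 1) (XMod A)) * (LinearMap.range (mulEnd p)).map (ExteriorAlgebra.ι A)

theorem D_mem_wedgeP (k : ℕ) (p : A[X]) (h : ℕ) (α : ExteriorAlgebra A (XMod A))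
    (hα : α ∈ wedgeP k p) : D A h α ∈ wedgeP k p := by
  rw [wedgeP] at hα ⊢
  induction hα using Submodule.mul_induction_on' with
  | mem_mul_mem a ha b hb =>
    rw [D, derivCoeff_mul]
    refine sum_mem fun x _ => Submodule.mul_mem_mul (derivCoeff_mem _ _ _ _ ha) ?_
    obtain ⟨_, ⟨m, rfl⟩, rfl⟩ := hb
    rw [derivCoeff_ι]
    refine ⟨_, ⟨mulEnd (X ^ x.2) m, rfl⟩, ?_⟩
    congr 1
    simp only [mulEnd, Algebra.lsmul_coe, smul_smul, mul_comm]
  | add a _ b _ ha hb =>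
    rw [map_add]
    exact add_mem ha hb

theorem opRing_mem_wedgeP (k : ℕ) (p : A[X]) (x : Module.End A (⋀[A]^k (XMod A)))
    (hx : x ∈ opRing A k) (α : ⋀[A]^k (XMod A))
    (hα : (α : ExteriorAlgebra A (XMod A)) ∈ wedgeP k p) :
    (x α : ExteriorAlgebra A (XMod A)) ∈ wedgeP k p := by
  induction hx using Algebra.adjoin_induction generalizing α with
  | mem x hx =>
    obtain ⟨i, rfl⟩ := hx
    exact D_mem_wedgeP k p _ _ hα
  | algebraMap a =>
    rw [Module.algebraMap_end_apply]
    exact Submodule.smul_mem _ a hα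
  | add x y _ _ hx hy => exact add_mem (hx α hα) (hy α hα)
  | mul x y _ _ hx hy => exact hx _ (hy α hα)

/-- The ideal `J_k(p)` of `A[D_1, …, D_k]`: the operators that send `ε^1 ∧ … ∧ ε^k` into
`⋀^{k-1} M ∧ pM`. -/
noncomputable def J (k : ℕ) (p : A[X]) : Ideal (opRing A k) where
  carrier := {x | ((x.1 (epsTop A k) : ⋀[A]^k (XMod A)) : ExteriorAlgebra A (XMod A)) ∈ wedgeP k p}
  zero_mem' := zero_mem (wedgeP k p)
  add_mem' hx hy := (wedgeP k p).add_mem hx hy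
  smul_mem' c _ hx := opRing_mem_wedgeP k p c.1 c.2 _ hx

variable (A)

/-- The sequence `T_0 = 1`, `T_1, …, T_k` the variables, `T_j = 0` for `j < 0`. (The value for
`j > k` plays no role below.) -/
noncomputable def T (k : ℕ) (j : ℤ) : MvPolynomial (Fin k) A :=
  if j = 0 then 1
  else if h : 1 ≤ j ∧ j ≤ k then MvPolynomial.X ⟨(j - 1).toNat, by omega⟩
  else 0

/-- The Schur polynomial `Δ_{(i_1,…,i_h)}(T) = det (T_{i_b - a})_{1 ≤ a, b ≤ h}`. -/
noncomputable def schur (k : ℕ) {h : ℕ} (I : Fin h → ℤ) : MvPolynomial (Fin k) A :=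
  Matrix.det (Matrix.of fun a b : Fin h => T A k (I b - ((a : ℕ) + 1 : ℤ)))

/-- The power series `1 - Δ_{(2)} t + Δ_{(2,3)} t² - … + (-1)^k Δ_{(2,3,…,k+1)} t^k`. -/
noncomputable def denom (k : ℕ) : PowerSeries (MvPolynomial (Fin k) A) :=
  PowerSeries.mk fun h =>
    if h ≤ k then (-1) ^ h * schur A k (fun b : Fin h => ((b : ℕ) + 2 : ℤ)) else 0

theorem constantCoeff_denom (k : ℕ) :
    PowerSeries.constantCoeff (denom A k) = ((1 : (MvPolynomial (Fin k) A)ˣ) : _) := by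
  simp [denom, schur, ← PowerSeries.coeff_zero_eq_constantCoeff_apply]

/-- `D̃_m(T_1, …, T_k)`: the coefficient of `t^m` in the inverse of the power series `denom`,
and `0` for `m < 0`. -/
noncomputable def Dtilde (k : ℕ) (m : ℤ) : MvPolynomial (Fin k) A :=
  if 0 ≤ m then PowerSeries.coeff m.toNat (PowerSeries.invOfUnit (denom A k) 1) else 0

theorem denom_mul_mk_Dtilde (k : ℕ) :
    denom A k * PowerSeries.mk (fun m : ℕ => Dtilde A k m) = 1 := by
  have : PowerSeries.mk (fun m : ℕ => Dtilde A k m) = PowerSeries.invOfUnit (denom A k) 1 := by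
    ext1 m
    simp [Dtilde]
  rw [this]
  exact PowerSeries.mul_invOfUnit _ _ (constantCoeff_denom A k)

variable {A}

/-- The coefficients `c_i` in `p = X^n + c_1 X^{n-1} + … + c_n`, with `c_i = 0` for `i > n`. -/
noncomputable def coeffC (p : A[X]) (i : ℕ) : A :=
  if i ≤ p.natDegree then p.coeff (p.natDegree - i) else 0

/-- `D̃_m(T_1, …, T_k; p) = D̃_m + ∑_{i=1}^m c_i D̃_{m-i}`. -/
noncomputable def DtildeP (k : ℕ) (p : A[X]) (m : ℤ) : MvPolynomial (Fin k) A :=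
  Dtilde A k m + ∑ i ∈ Finset.Icc 1 m.toNat, coeffC p i • Dtilde A k (m - i)

end GrassmannAlgebra

/-! The key is an `A`-linear form on `⋀^k M` with values in `A[T_1, …, T_k]`, namely `ε^{i_1} ∧ … ∧
ε^{i_k} ↦ det (D̃_{i_b - a})` with `1 ≤ a, b ≤ k` (`detForm` of `shiftForm`). It sends `ε^1 ∧ … ∧
ε^k` to `1` and turns `D_h` into multiplication by `D̃_h`, where `D̃_h = T_h` for `1 ≤ h ≤ k`. So it
recovers `P` from `P(D)(ε^1 ∧ … ∧ ε^k)` (`detForm_shiftForm_evD`). If this element lies in `⋀^{k-1}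
M ∧ pM`, a determinant with one row coming from `pM` is expanded along that row: its entries are
combinations of `D̃_m(T, p)` with `m ≥ n - k + 1`, and the order-`k` recurrence puts all of these in
the ideal generated by the first `k` (`detForm_shiftForm_mem`).

Conversely, on `⋀^k M` the series `∑ D_h t^h` has an inverse of degree at most `k`, so `D̃_m(D) =
D_m` for every `m ≥ 0` (`evEnd_Dtilde`). Since `D_h` moves only the last factor of `ε^1 ∧ … ∧ ε^k`
(`D_ιMulti_eps`), the operator `D̃_{n-k+j}(D, p)` sends this element to `ε^1 ∧ … ∧ ε^{k-1} ∧ p ε^j`.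

This proves the polynomial statement; the one for `J_k(p)` is its image under the surjection `P ↦
P(D)`. -/

namespace GrassmannAlgebra

/-! ### Inverses of power series up to a given order -/

section PowerSeriesInverse

variable {B : Type*} [Semiring B]

theorem coeff_mul_congr {a a' b b' : PowerSeries B} {k : ℕ}
    (ha : ∀ i ≤ k, PowerSeries.coeff i a = PowerSeries.coeff i a')
    (hb : ∀ i ≤ k, PowerSeries.coeff i b = PowerSeries.coeff i b') :
    ∀ i ≤ k, PowerSeries.coeff i (a * b) = PowerSeries.coeff i (a' * b') := by
  intro i hi
  rw [PowerSeries.coeff_mul, PowerSeries.coeff_mul]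
  refine Finset.sum_congr rfl fun x hx => ?_
  have := Finset.HasAntidiagonal.mem_antidiagonal.1 hx
  rw [ha x.1 (by omega), hb x.2 (by omega)]

/-- Inverses of power series that agree up to order `k` agree up to order `k`. -/
theorem coeff_inv_congr {a b c d : PowerSeries B} {k : ℕ} (hab : a * b = 1) (hcd : c * d = 1)
    (h : ∀ i ≤ k, PowerSeries.coeff i b = PowerSeries.coeff i c) :
    ∀ i ≤ k, PowerSeries.coeff i a = PowerSeries.coeff i d := by
  have h1 : a = a * (c * d) := by rw [hcd, mul_one]
  have h2 : d = a * (b * d) := by rw [← mul_assoc, hab, one_mul]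
  intro i hi
  rw [h1]
  conv_rhs => rw [h2]
  exact coeff_mul_congr (fun _ _ => rfl)
    (coeff_mul_congr (fun j hj => (h j hj).symm) (fun _ _ => rfl)) i hi

end PowerSeriesInverse

/-! ### Toeplitz determinants -/

section Toeplitz

variable {R : Type*} [CommRing R]

/-- The coefficients of the inverse of a power series as Toeplitz determinants. -/
theorem det_toeplitz_eq_coeff_inv (u : ℤ → R) (hu0 : u 0 = 1) (hu : ∀ j < 0, u j = 0)
    (ψ : PowerSeries R) (hψ : PowerSeries.mk (fun j : ℕ => u j) * ψ = 1) (h : ℕ) :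
    (-1) ^ h * Matrix.det (Matrix.of fun a b : Fin h => u ((b : ℕ) - (a : ℕ) + 1)) =
      PowerSeries.coeff h ψ := by
  -- Cramer's rule for a unitriangular system: `U` sends the reversed coefficients of `ψ` to the
  -- last basis vector, and the corner entry of the adjugate of `U` is the required determinant up
  -- to sign.
  let U : Matrix (Fin (h + 1)) (Fin (h + 1)) R := Matrix.of fun i j => u ((j : ℕ) - (i : ℕ))
  have hdet : U.det = 1 := by
    rw [Matrix.det_of_isUpperTriangular]
    · simp [U, hu0]
    · intro i j hij
      exact hu _ (by simp only [id] at hij; have := Fin.lt_def.1 hij; omega)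
  let v : Fin (h + 1) → R := fun j => PowerSeries.coeff (h - j) ψ
  have hUv : U.mulVec v = Pi.single (Fin.last h) 1 := by
    funext i
    obtain ⟨m, hm⟩ := Nat.exists_eq_add_of_le (Nat.le_of_lt_succ i.2)
    have h1 : U.mulVec v i =
        ∑ j ∈ Finset.range (h + 1), u ((j : ℕ) - (i : ℕ)) * PowerSeries.coeff (h - j) ψ := by
      rw [Finset.sum_range]
      rfl
    have h2 : PowerSeries.coeff m (PowerSeries.mk (fun j : ℕ => u j) * ψ) =
        ∑ j ∈ Finset.range (m + 1), u j * PowerSeries.coeff (m - j) ψ := by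
      rw [PowerSeries.coeff_mul, Finset.Nat.sum_antidiagonal_eq_sum_range_succ_mk]
      simp
    have h0 : Finset.range (h + 1) = Finset.range (i + (m + 1)) := by
      congr 1
      omega
    rw [h1, h0, Finset.sum_range_add, Finset.sum_eq_zero, zero_add]
    · have h3 : ∑ j ∈ Finset.range (m + 1), u (((i : ℕ) + j : ℕ) - (i : ℕ)) *
          PowerSeries.coeff (h - ((i : ℕ) + j)) ψ = PowerSeries.coeff m (1 : PowerSeries R) := by
        rw [← hψ, h2]
        refine Finset.sum_congr rfl fun j _ => ?_
        congr 2
        · push_cast; ring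
        · congr 1; omega
      rw [h3, PowerSeries.coeff_one, Pi.single_apply]
      congr 1
      rw [Fin.ext_iff, Fin.val_last, eq_iff_iff]
      omega
    · intro j hj
      rw [hu, zero_mul]
      have := Finset.mem_range.1 hj
      omega
  have hv : v = U.adjugate.mulVec (Pi.single (Fin.last h) 1) := by
    rw [← hUv, Matrix.mulVec_mulVec, Matrix.adjugate_mul, hdet, one_smul, Matrix.one_mulVec]
  have hv0 := congrFun hv 0
  rw [Matrix.mulVec_single_one, Matrix.col_apply,
    Matrix.adjugate_fin_succ_eq_det_submatrix] at hv0
  simp only [v, Fin.val_zero, Nat.sub_zero, Fin.val_last, add_zero] at hv0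
  rw [hv0]
  congr 2
  ext a b
  simp only [U, Matrix.of_apply, Matrix.submatrix_apply, Fin.succAbove_last, Fin.succAbove_zero,
    Fin.val_castSucc, Fin.val_succ]
  congr 1
  push_cast
  ring

end Toeplitz

/-! ### The polynomials `D̃_m` and their recurrence -/

section Tilde

variable (A : Type*) [CommRing A]

theorem T_zero (k : ℕ) : T A k 0 = 1 := by simp [T]

theorem T_of_neg (k : ℕ) (j : ℤ) (hj : j < 0) : T A k j = 0 := by
  rw [T, if_neg (by omega), dif_neg (by omega)]

theorem T_succ (k : ℕ) (i : Fin k) : T A k ((i : ℕ) + 1 : ℕ) = MvPolynomial.X i := by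
  rw [T, if_neg (by omega), dif_pos (by omega)]
  congr 1
  ext
  simp

/-- The Schur determinants in `denom` are Toeplitz, so `denom` is the inverse of `∑ T_j t^j`
truncated after degree `k`. -/
theorem coeff_denom_of_le (k h : ℕ) (hh : h ≤ k) (ψ : PowerSeries (MvPolynomial (Fin k) A))
    (hψ : PowerSeries.mk (fun j : ℕ => T A k j) * ψ = 1) :
    PowerSeries.coeff h (denom A k) = PowerSeries.coeff h ψ := by
  rw [← det_toeplitz_eq_coeff_inv (T A k) (T_zero A k) (T_of_neg A k) ψ hψ, denom,
    PowerSeries.coeff_mk, if_pos hh, schur]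
  congr 3
  ext1 a
  funext b
  congr 1
  ring

theorem coeff_denom_of_gt (k h : ℕ) (hh : k < h) : PowerSeries.coeff h (denom A k) = 0 := by
  rw [denom, PowerSeries.coeff_mk, if_neg (by omega)]

theorem exists_mk_T_mul_eq_one (k : ℕ) :
    ∃ ψ, PowerSeries.mk (fun j : ℕ => T A k j) * ψ = 1 :=
  ⟨_, PowerSeries.mul_invOfUnit _ 1 (by
    simp [← PowerSeries.coeff_zero_eq_constantCoeff_apply, T_zero])⟩

/-- Truncating after degree `k` does not affect the inverse up to order `k`, so inverting twice
gives back the variables. -/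
theorem Dtilde_eq_T (k m : ℕ) (hm : m ≤ k) : Dtilde A k m = T A k m := by
  obtain ⟨ψ, hψ⟩ := exists_mk_T_mul_eq_one A k
  have := coeff_inv_congr (k := k) hψ (denom_mul_mk_Dtilde A k)
    (fun i hi => (coeff_denom_of_le A k i hi ψ hψ).symm) m hm
  simpa using this.symm

theorem Dtilde_of_neg (k : ℕ) (m : ℤ) (hm : m < 0) : Dtilde A k m = 0 := by
  rw [Dtilde, if_neg (by omega)]

theorem coeff_zero_denom (k : ℕ) : PowerSeries.coeff 0 (denom A k) = 1 := by
  rw [PowerSeries.coeff_zero_eq_constantCoeff_apply, constantCoeff_denom, Units.val_one]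

theorem Dtilde_zero (k : ℕ) : Dtilde A k 0 = 1 := by
  have := Dtilde_eq_T A k 0 (Nat.zero_le _)
  rw [Nat.cast_zero] at this
  rw [this, T_zero]

/-- The linear recurrence satisfied by the `D̃_m`. -/
theorem Dtilde_recurrence (k : ℕ) (m : ℤ) (hm : 0 < m) :
    Dtilde A k m =
      -∑ r ∈ Finset.range k, PowerSeries.coeff (r + 1) (denom A k) * Dtilde A k (m - (r + 1)) := by
  lift m to ℕ using hm.le
  have h1 := congrArg (PowerSeries.coeff m) (denom_mul_mk_Dtilde A k)
  rw [PowerSeries.coeff_one, if_neg (by omega), PowerSeries.coeff_mul,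
    Finset.Nat.sum_antidiagonal_eq_sum_range_succ_mk] at h1
  have h2 : ∀ N, ∑ r ∈ Finset.range (N + 1),
      PowerSeries.coeff r (denom A k) * Dtilde A k ((m : ℤ) - r) = Dtilde A k m +
      ∑ r ∈ Finset.range N,
        PowerSeries.coeff (r + 1) (denom A k) * Dtilde A k ((m : ℤ) - (r + 1)) := by
    intro N
    rw [Finset.sum_range_succ', coeff_zero_denom, add_comm]
    simp
  have h3 : ∑ r ∈ Finset.range (m + 1),
      PowerSeries.coeff r (denom A k) * Dtilde A k ((m : ℤ) - r) = 0 := by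
    rw [← h1]
    refine Finset.sum_congr rfl fun r hr => ?_
    have := Finset.mem_range.1 hr
    rw [PowerSeries.coeff_mk, Nat.cast_sub (by omega)]
  -- The convolution sum stops at `m` and the recurrence at `k`; both are compared with a common
  -- longer range. The extra terms vanish since `D̃` is zero at negative indices and `denom` has
  -- degree at most `k`.
  have h4 : ∀ a b : ℕ, a ≤ b → (∀ r, a ≤ r → PowerSeries.coeff r (denom A k) *
      Dtilde A k ((m : ℤ) - r) = 0) → ∑ r ∈ Finset.range b,
      PowerSeries.coeff r (denom A k) * Dtilde A k ((m : ℤ) - r) = ∑ r ∈ Finset.range a,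
      PowerSeries.coeff r (denom A k) * Dtilde A k ((m : ℤ) - r) := by
    intro a b hab h
    refine (Finset.sum_subset (Finset.range_mono hab) fun r _ hr => h r ?_).symm
    simpa using hr
  have h5 := h4 (m + 1) (max (m + 1) (k + 1)) (le_max_left _ _) fun r hr => by
    rw [Dtilde_of_neg _ _ _ (by omega), mul_zero]
  have h6 := h4 (k + 1) (max (m + 1) (k + 1)) (le_max_right _ _) fun r hr => by
    rw [coeff_denom_of_gt _ _ _ (by omega), zero_mul]
  rw [h5.symm.trans h6, h2] at h3
  exact eq_neg_of_add_eq_zero_left h3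

end Tilde

/-! ### Determinantal forms on the exterior algebra -/

section DetForm

variable {A : Type*} [CommRing A] {M : Type*} [AddCommGroup M] [Module A M]
  {R : Type*} [CommRing R] [Algebra A R]

/-- The alternating form `(m_0, …, m_{j-1}) ↦ det (l_a(m_b))` attached to a sequence of linear
maps `l_a : M → R`. -/
noncomputable def detAlternating (l : ℕ → M →ₗ[A] R) (j : ℕ) : M [⋀^Fin j]→ₗ[A] R :=
  { ((Matrix.detRowAlternating (R := R) (n := Fin j)).toMultilinearMap.restrictScalars
      A).compLinearMap (fun _ => LinearMap.pi fun a : Fin j => l a) with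
    map_eq_zero_of_eq' := fun f _ _ hfxy hxy =>
      (Matrix.detRowAlternating (R := R) (n := Fin j)).map_eq_zero_of_eq
        (fun b => LinearMap.pi (fun a : Fin j => l a) (f b)) (congrArg _ hfxy) hxy }

/-- The linear form on `⋀ M` given in each degree by `detAlternating`. -/
noncomputable def detForm (l : ℕ → M →ₗ[A] R) : ExteriorAlgebra A M →ₗ[A] R :=
  ExteriorAlgebra.liftAlternating (detAlternating l)

theorem detForm_ιMulti (l : ℕ → M →ₗ[A] R) (j : ℕ) (f : Fin j → M) :
    detForm l (ExteriorAlgebra.ιMulti A j f) =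
      Matrix.det (Matrix.of fun b a : Fin j => l a (f b)) :=
  ExteriorAlgebra.liftAlternating_apply_ιMulti _ _

/-- The order embedding of `ℕ` into itself that skips `a`. -/
def skip (a i : ℕ) : ℕ := if i < a then i else i + 1

theorem val_succAbove (j : ℕ) (a : Fin (j + 1)) (i : Fin j) :
    ((a.succAbove i : Fin (j + 1)) : ℕ) = skip a i := by
  simp only [Fin.succAbove, Fin.lt_def, skip, Fin.val_castSucc]
  split_ifs <;> simp

/-- Laplace expansion. -/
theorem detForm_ι_mul (l : ℕ → M →ₗ[A] R) (j : ℕ) (m : M) (β : ExteriorAlgebra A M)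
    (hβ : β ∈ ⋀[A]^j M) :
    detForm l (ExteriorAlgebra.ι A m * β) =
      ∑ a : Fin (j + 1), (-1) ^ (a : ℕ) * l a m * detForm (fun i => l (skip a i)) β := by
  rw [← ExteriorAlgebra.ιMulti_span_fixedDegree] at hβ
  induction hβ using Submodule.span_induction with
  | mem x hx =>
    obtain ⟨f, rfl⟩ := hx
    have : ExteriorAlgebra.ι A m * ExteriorAlgebra.ιMulti A j f =
        ExteriorAlgebra.ιMulti A (j + 1) (Matrix.vecCons m f) := by
      rw [ExteriorAlgebra.ιMulti_succ_apply]
      simp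
    rw [this, detForm_ιMulti, Matrix.det_succ_row_zero]
    refine Finset.sum_congr rfl fun a _ => ?_
    rw [detForm_ιMulti]
    congr 2
    ext b i
    simp [val_succAbove]
  | zero => simp
  | add x y _ _ hx hy => simp only [mul_add, map_add, hx, hy, Finset.sum_add_distrib]
  | smul c x _ hx => simp only [mul_smul_comm, map_smul, hx, Finset.smul_sum]

/-- The generating series `∑ l(f_h(m)) t^h`. -/
noncomputable def genForm (f : ℕ → Module.End A M) (l : M →ₗ[A] R) (m : M) : PowerSeries R :=
  PowerSeries.mk fun h => l (f h m)

/-- As `D_t` is multiplicative, it replaces each vector of a wedge by its generating series. The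
induction removes the first vector by Laplace expansion, which deletes one of the forms; hence `l`
has to vary. -/
theorem detForm_derivCoeff_ιMulti (f : ℕ → Module.End A M) (j : ℕ) (l : ℕ → M →ₗ[A] R)
    (v : Fin j → M) (h : ℕ) :
    detForm l (derivCoeff f h (ExteriorAlgebra.ιMulti A j v)) = PowerSeries.coeff h
      (Matrix.det (Matrix.of fun b a : Fin j => genForm f (l a) (v b))) := by
  induction j generalizing l h with
  | zero =>
    have h1 := derivCoeff_algebraMap (M := M) f h (1 : A)
    rw [map_one] at h1
    have h2 := detForm_ιMulti l 0 v
    rw [ExteriorAlgebra.ιMulti_zero_apply] at h2 ⊢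
    rw [h1, Matrix.det_isEmpty, PowerSeries.coeff_one]
    split_ifs
    · rw [h2, Matrix.det_isEmpty]
    · simp
  | succ j ih =>
    rw [ExteriorAlgebra.ιMulti_succ_apply, derivCoeff_mul, map_sum, Matrix.det_succ_row_zero,
      map_sum]
    have h1 : ∀ x ∈ Finset.HasAntidiagonal.antidiagonal h,
        detForm l (derivCoeff f x.1 (ExteriorAlgebra.ι A (v 0)) *
          derivCoeff f x.2 (ExteriorAlgebra.ιMulti A j (Matrix.vecTail v))) =
        ∑ a : Fin (j + 1), (-1) ^ (a : ℕ) * l a (f x.1 (v 0)) *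
          PowerSeries.coeff x.2 (Matrix.det (Matrix.of fun b i : Fin j =>
            genForm f (l (skip a i)) (v b.succ))) := by
      intro x _
      rw [derivCoeff_ι, detForm_ι_mul l j _ _ (derivCoeff_mem _ _ _ _
        (ExteriorAlgebra.ιMulti_range A j ⟨_, rfl⟩))]
      refine Finset.sum_congr rfl fun a _ => ?_
      rw [ih]
      rfl
    rw [Finset.sum_congr rfl h1, Finset.sum_comm]
    refine Finset.sum_congr rfl fun a _ => ?_
    have h2 : ((-1 : PowerSeries R) ^ (a : ℕ)) = PowerSeries.C ((-1) ^ (a : ℕ)) := by simp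
    rw [h2, mul_assoc, PowerSeries.coeff_C_mul, PowerSeries.coeff_mul, Finset.mul_sum]
    refine Finset.sum_congr rfl fun x _ => ?_
    rw [mul_assoc]
    congr 2
    · simp [genForm]
    · congr 2
      ext b i : 2
      simp [val_succAbove]

/-- If a common companion matrix `C` expresses `l_a ∘ g` through the `l_a`, then on `⋀^k M` the
generating series of the derivation attached to the powers of `g` is multiplication by a
power series. -/
theorem exists_detForm_derivCoeff_powers (g : Module.End A M) (k : ℕ) (l : ℕ → M →ₗ[A] R)
    (C : Matrix (Fin k) (Fin k) R)
    (hC : ∀ (a : Fin k) (m : M), l a (g m) = ∑ a' : Fin k, C a a' * l a' m) :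
    ∃ d : PowerSeries R, ∀ α ∈ ⋀[A]^k M,
      PowerSeries.mk (fun h => detForm l (derivCoeff (fun i => g ^ i) h α)) * d =
        PowerSeries.C (detForm l α) := by
  let N : Matrix (Fin k) (Fin k) (PowerSeries R) :=
    1 - (PowerSeries.X : PowerSeries R) • (C.map (PowerSeries.C (R := R))).transpose
  refine ⟨N.det, fun α hα => ?_⟩
  rw [← ExteriorAlgebra.ιMulti_span_fixedDegree] at hα
  induction hα using Submodule.span_induction with
  | mem x hx =>
    obtain ⟨v, rfl⟩ := hx
    let G : Matrix (Fin k) (Fin k) (PowerSeries R) :=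
      Matrix.of fun b a => genForm (fun i => g ^ i) (l a) (v b)
    let F : Matrix (Fin k) (Fin k) R := Matrix.of fun b a => l a (v b)
    have h1 : PowerSeries.mk (fun h => detForm l (derivCoeff (fun i => g ^ i) h
        (ExteriorAlgebra.ιMulti A k v))) = G.det := by
      ext h
      rw [PowerSeries.coeff_mk, detForm_derivCoeff_ιMulti]
    -- The companion relation says `G = F + t G Cᵀ`: each coefficient of `G` is the previous one
    -- times `Cᵀ`.
    have h2 : G * N = F.map (PowerSeries.C (R := R)) := by
      rw [show N = 1 - (PowerSeries.X : PowerSeries R) •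
        (C.map (PowerSeries.C (R := R))).transpose from rfl, mul_sub, mul_one, Matrix.mul_smul]
      ext b a h
      simp only [Matrix.sub_apply, Matrix.smul_apply, smul_eq_mul, Matrix.mul_apply,
        Matrix.transpose_apply, Matrix.map_apply, map_sub]
      cases h with
      | zero => simp [G, F, genForm]
      | succ h =>
        rw [PowerSeries.coeff_succ_X_mul, map_sum, PowerSeries.coeff_C, if_neg (by omega),
          sub_eq_zero]
        simp only [G, genForm, Matrix.of_apply, PowerSeries.coeff_mk, PowerSeries.coeff_mul_C]
        rw [pow_succ', Module.End.mul_apply, hC]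
        exact Finset.sum_congr rfl fun a' _ => mul_comm _ _
    rw [h1, ← Matrix.det_mul, h2, detForm_ιMulti]
    exact (RingHom.map_det (PowerSeries.C (R := R)) F).symm
  | zero =>
    simp only [map_zero]
    convert zero_mul _
    ext
    simp
  | add x y _ _ hx hy =>
    rw [map_add, map_add, ← hx, ← hy, ← add_mul]
    congr 1
    ext h
    simp
  | smul c x _ hx =>
    rw [map_smul, Algebra.smul_def c (detForm l x), map_mul, ← hx, ← mul_assoc]
    congr 1
    ext h
    simp only [PowerSeries.coeff_mk, PowerSeries.coeff_C_mul, map_smul,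
      Algebra.smul_def c (detForm l _)]

end DetForm

/-! ### The action of `D_h` on `ε^1 ∧ … ∧ ε^k` -/

section TopWedge

variable (A : Type*) [CommRing A]

theorem D_eq (h : ℕ) : D A h = derivCoeff (fun i => mulEnd (X : A[X]) ^ i) h := by
  rw [D]
  congr 1
  funext i
  rw [mulEnd, mulEnd, map_pow]

theorem mulEnd_eps (h i : ℕ) : mulEnd (X ^ h : A[X]) (eps A i) = eps A (i + h) := by
  apply Subtype.ext
  change (X : A[X]) ^ h * X ^ (i + 1) = X ^ (i + h + 1)
  ring

theorem genMap_eps (i : ℕ) :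
    genMap (fun h => mulEnd (X ^ h)) (eps A i) =
      PowerSeries.C (ExteriorAlgebra.ι A (eps A i)) +
        PowerSeries.X * genMap (fun h => mulEnd (X ^ h)) (eps A (i + 1)) := by
  ext h
  cases h with
  | zero => simp [genMap, mulEnd_eps]
  | succ h =>
    rw [map_add, PowerSeries.coeff_C, if_neg (by omega), zero_add, PowerSeries.coeff_succ_X_mul]
    simp only [genMap, LinearMap.coe_mk, AddHom.coe_mk, PowerSeries.coeff_mk, mulEnd_eps]
    congr 2
    omega

/-- By `genMap_eps`, the series of each vector is the vector itself plus `t` times the series of the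
next one. That second term is killed by the next factor, so only the last factor keeps its full
series. -/
theorem derivation_ιMulti_eps (k i : ℕ) :
    derivation (fun h => mulEnd (X ^ h))
        (ExteriorAlgebra.ιMulti A (k + 1) fun b : Fin (k + 1) => eps A (i + b)) =
      PowerSeries.C (ExteriorAlgebra.ιMulti A k fun b : Fin k => eps A (i + b)) *
        genMap (fun h => mulEnd (X ^ h)) (eps A (i + k)) := by
  have hι : ∀ m : XMod A, derivation (fun h => mulEnd (X ^ h)) (ExteriorAlgebra.ι A m) =
      genMap (fun h => mulEnd (X ^ h)) m := fun m => by simp [derivation]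
  have htail : ∀ k i : ℕ, Matrix.vecTail (fun b : Fin (k + 1) => eps A (i + b)) =
      fun b : Fin k => eps A (i + 1 + b) := fun k i => by
    funext b
    simp only [Matrix.vecTail, Function.comp_apply, Fin.val_succ]
    congr 1
    omega
  induction k generalizing i with
  | zero => simp [hι]
  | succ k ih =>
    have hsq : genMap (fun h => mulEnd (X ^ h)) (eps A (i + 1)) *
        derivation (fun h => mulEnd (X ^ h))
          (ExteriorAlgebra.ιMulti A (k + 1) fun b : Fin (k + 1) => eps A (i + 1 + b)) = 0 := by
      rw [ExteriorAlgebra.ιMulti_succ_apply, map_mul, hι, ← mul_assoc, Fin.val_zero, add_zero,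
        genMap_sq, zero_mul]
    rw [ExteriorAlgebra.ιMulti_succ_apply, htail, map_mul, hι, Fin.val_zero, add_zero, genMap_eps,
      add_mul, mul_assoc, hsq, mul_zero, add_zero, ih, ← mul_assoc, ← map_mul,
      ExteriorAlgebra.ιMulti_succ_apply, htail, Fin.val_zero, add_zero,
      show i + 1 + k = i + (k + 1) by omega]

theorem D_ιMulti_eps (k h : ℕ) :
    D A h (ExteriorAlgebra.ιMulti A (k + 1) fun b : Fin (k + 1) => eps A b) =
      ExteriorAlgebra.ιMulti A k (fun b : Fin k => eps A b) *
        ExteriorAlgebra.ι A (eps A (k + h)) := by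
  have h1 := congrArg (PowerSeries.coeff h) (derivation_ιMulti_eps A k 0)
  simp only [zero_add] at h1
  rw [PowerSeries.coeff_C_mul] at h1
  refine h1.trans ?_
  simp only [genMap, LinearMap.coe_mk, AddHom.coe_mk, PowerSeries.coeff_mk, mulEnd_eps]

end TopWedge

/-! ### The determinantal form with values in `A[T_1, …, T_k]` -/

section ShiftForm

variable (A : Type*) [CommRing A]

/-- The `A`-linear surjection `A[X] → X A[X]`, `q ↦ q X`. -/
noncomputable def mulXMap : A[X] →ₗ[A] XMod A :=
  (LinearMap.toSpanSingleton A[X] (XMod A) (eps A 0)).restrictScalars A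

theorem mulXMap_surjective : Function.Surjective (mulXMap A) := by
  rintro ⟨f, hf⟩
  obtain ⟨q, rfl⟩ := Ideal.mem_span_singleton.1 hf
  refine ⟨q, Subtype.ext ?_⟩
  change q * X ^ (0 + 1) = X * q
  ring

theorem mulXMap_X_pow (i : ℕ) : mulXMap A (X ^ i) = eps A i := by
  apply Subtype.ext
  change (X : A[X]) ^ i * X ^ (0 + 1) = X ^ (i + 1)
  ring

variable {A} in
theorem XMod.linearMap_ext {N : Type*} [AddCommGroup N] [Module A N] {f g : XMod A →ₗ[A] N}
    (h : ∀ i, f (eps A i) = g (eps A i)) : f = g := by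
  have : f ∘ₗ mulXMap A = g ∘ₗ mulXMap A := by
    refine Polynomial.lhom_ext' fun i => LinearMap.ext_ring ?_
    simpa [Polynomial.monomial_one_right_eq_X_pow, mulXMap_X_pow] using h i
  refine LinearMap.ext fun m => ?_
  obtain ⟨q, rfl⟩ := mulXMap_surjective A m
  exact LinearMap.congr_fun this q

variable {A} in
theorem mulEnd_eps_eq_sum (p : A[X]) (j : ℕ) :
    mulEnd p (eps A j) =
      ∑ i ∈ Finset.range (p.natDegree + 1), p.coeff i • eps A (i + j) := by
  conv_lhs => rw [p.as_sum_range_C_mul_X_pow]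
  rw [mulEnd, map_sum, LinearMap.sum_apply]
  refine Finset.sum_congr rfl fun i _ => ?_
  rw [map_mul, Module.End.mul_apply, add_comm i j, ← mulEnd_eps, ← mulEnd, mulEnd,
    Algebra.lsmul_coe]
  exact algebraMap_smul A[X] (p.coeff i) _

/-- The linear map `M → A[T_1, …, T_k]` with `ε^{i+1} ↦ D̃_{i-a}`. -/
noncomputable def shiftForm (k a : ℕ) : XMod A →ₗ[A] MvPolynomial (Fin k) A :=
  (Polynomial.lsum fun i : ℕ => LinearMap.toSpanSingleton A (MvPolynomial (Fin k) A)
      (Dtilde A k ((i : ℤ) - 1 - a))) ∘ₗ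
    (Submodule.subtype (Ideal.span {(X : A[X])} : Ideal A[X])).restrictScalars A

theorem shiftForm_eps (k a i : ℕ) : shiftForm A k a (eps A i) = Dtilde A k ((i : ℤ) - a) := by
  change Polynomial.lsum (fun i : ℕ => LinearMap.toSpanSingleton A (MvPolynomial (Fin k) A)
      (Dtilde A k ((i : ℤ) - 1 - a))) (X ^ (i + 1)) = _
  rw [← Polynomial.monomial_one_right_eq_X_pow, Polynomial.lsum_apply,
    Polynomial.sum_monomial_index _ _ (by simp)]
  simp

/-- The matrix that expresses the forms `shiftForm A k a ∘ X` through the `shiftForm A k a`. -/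
noncomputable def shiftMatrix (k : ℕ) : Matrix (Fin k) (Fin k) (MvPolynomial (Fin k) A) :=
  Matrix.of fun a a' => if (a : ℕ) = 0 then -PowerSeries.coeff (a' + 1) (denom A k)
    else if (a' : ℕ) + 1 = a then 1 else 0

/-- Multiplication by `X` turns the form of index `a ≥ 1` into that of index `a - 1`. For `a = 0`
the resulting `D̃` has positive index on every basis vector, so the recurrence applies. -/
theorem shiftForm_mulEnd_X (k : ℕ) (a : Fin k) (m : XMod A) :
    shiftForm A k a (mulEnd X m) = ∑ a' : Fin k, shiftMatrix A k a a' * shiftForm A k a' m := by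
  have : shiftForm A k a ∘ₗ mulEnd X =
      ∑ a' : Fin k, LinearMap.mulLeft A (shiftMatrix A k a a') ∘ₗ shiftForm A k a' := by
    refine XMod.linearMap_ext fun i => ?_
    have hX : mulEnd X (eps A i) = eps A (i + 1) := by
      simpa using mulEnd_eps A 1 i
    simp only [LinearMap.sum_apply, LinearMap.comp_apply, LinearMap.mulLeft_apply, hX,
      shiftForm_eps, shiftMatrix, Matrix.of_apply]
    by_cases ha : (a : ℕ) = 0
    · simp only [ha, if_true]
      rw [Dtilde_recurrence A k _ (by omega), Finset.sum_range, ← Finset.sum_neg_distrib]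
      refine Finset.sum_congr rfl fun r _ => ?_
      rw [neg_mul]
      congr 3
      push_cast
      ring
    · simp only [ha, if_false]
      have ha' := a.2
      rw [Finset.sum_eq_single ⟨(a : ℕ) - 1, by omega⟩]
      · rw [if_pos (by simp only; omega), one_mul]
        congr 1
        push_cast
        omega
      · intro b _ hb
        rw [if_neg, zero_mul]
        intro h
        exact hb (Fin.ext (by simp only; omega))
      · simp
  simpa using LinearMap.congr_fun this m

theorem ιMulti_mul_ι {M : Type*} [AddCommGroup M] [Module A M] (k : ℕ) (f : Fin k → M) (m : M) :
    ExteriorAlgebra.ιMulti A k f * ExteriorAlgebra.ι A m =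
      ExteriorAlgebra.ιMulti A (k + 1) (Fin.snoc f m : Fin (k + 1) → M) := by
  rw [ExteriorAlgebra.ιMulti_apply, ExteriorAlgebra.ιMulti_apply, List.ofFn_succ',
    List.concat_eq_append, List.prod_append]
  simp

theorem ιMulti_eps_mul_ι (k : ℕ) :
    ExteriorAlgebra.ιMulti A k (fun b : Fin k => eps A b) * ExteriorAlgebra.ι A (eps A k) =
      ExteriorAlgebra.ιMulti A (k + 1) fun b : Fin (k + 1) => eps A b := by
  rw [ιMulti_mul_ι]
  congr 1
  funext b
  refine Fin.lastCases ?_ (fun b => ?_) b <;> simp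

/-- The matrix is lower triangular, with diagonal entries `D̃_0 = 1` except for `D̃_h` in the last
row. -/
theorem detForm_shiftForm_eps (k h : ℕ) :
    detForm (shiftForm A (k + 1)) (ExteriorAlgebra.ιMulti A k (fun b : Fin k => eps A b) *
      ExteriorAlgebra.ι A (eps A (k + h))) = Dtilde A (k + 1) h := by
  rw [ιMulti_mul_ι, detForm_ιMulti, Matrix.det_of_isLowerTriangular]
  · rw [Fin.prod_univ_castSucc]
    simp [shiftForm_eps, Dtilde_zero]
  · intro b a hab
    have hab' : b < a := hab
    obtain ⟨b, rfl⟩ := Fin.exists_castSucc_eq.2 (ne_of_lt (hab'.trans_le (Fin.le_last a)))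
    have := Fin.lt_def.1 hab'
    rw [Fin.val_castSucc] at this
    simp only [Matrix.of_apply, Fin.snoc_castSucc, shiftForm_eps]
    exact Dtilde_of_neg _ _ _ (by omega)

theorem detForm_shiftForm_top (k : ℕ) :
    detForm (shiftForm A (k + 1))
      (ExteriorAlgebra.ιMulti A (k + 1) fun b : Fin (k + 1) => eps A b) = 1 := by
  have := detForm_shiftForm_eps A k 0
  rw [add_zero, ιMulti_eps_mul_ι, Nat.cast_zero, Dtilde_zero] at this
  exact this

/-- On `⋀^k M` the form `detForm (shiftForm A k)` turns `D_h` into multiplication by `D̃_h`. -/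
theorem detForm_shiftForm_D (k h : ℕ) (α : ExteriorAlgebra A (XMod A))
    (hα : α ∈ ⋀[A]^(k + 1) (XMod A)) :
    detForm (shiftForm A (k + 1)) (D A h α) =
      Dtilde A (k + 1) h * detForm (shiftForm A (k + 1)) α := by
  obtain ⟨d, hd⟩ := exists_detForm_derivCoeff_powers (mulEnd (X : A[X])) (k + 1)
    (shiftForm A (k + 1)) (shiftMatrix A (k + 1)) (shiftForm_mulEnd_X A (k + 1))
  simp only [← D_eq] at hd
  -- Evaluation at the top wedge identifies `d` as the inverse of `∑ D̃_h t^h`, with no need to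
  -- compute a determinant.
  have htop := hd _ (ExteriorAlgebra.ιMulti_range A (k + 1) ⟨fun b => eps A b, rfl⟩)
  simp only [D_ιMulti_eps, detForm_shiftForm_eps, detForm_shiftForm_top, map_one] at htop
  have h1 := congrArg (PowerSeries.coeff h) (congrArg
    (fun z => PowerSeries.mk (fun m : ℕ => Dtilde A (k + 1) m) * z) (hd α hα))
  rw [mul_left_comm, htop, mul_one, PowerSeries.coeff_mk, PowerSeries.coeff_mul_C,
    PowerSeries.coeff_mk] at h1
  exact h1

/-- It suffices to treat the generators, and `D_i` acts as `D̃_i = T_i` for `1 ≤ i ≤ k + 1`. -/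
theorem detForm_shiftForm_evD (k : ℕ) (P : MvPolynomial (Fin (k + 1)) A)
    (α : ⋀[A]^(k + 1) (XMod A)) :
    detForm (shiftForm A (k + 1)) ((evD A (k + 1) P).1 α : ⋀[A]^(k + 1) (XMod A)) =
      P * detForm (shiftForm A (k + 1)) α := by
  induction P using MvPolynomial.induction_on generalizing α with
  | C a =>
    have h1 : evD A (k + 1) (MvPolynomial.C a) = algebraMap A _ a := (evD A (k + 1)).commutes a
    rw [h1, ← MvPolynomial.algebraMap_eq, ← Algebra.smul_def, ← map_smul]
    rfl
  | add P Q hP hQ =>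
    rw [map_add, add_mul, ← hP, ← hQ]
    exact map_add (detForm (shiftForm A (k + 1))) _ _
  | mul_X P i hP =>
    have h1 : (evD A (k + 1) (MvPolynomial.X i)).1 = Dk A (k + 1) (i + 1) := by
      simp [evD]
    have h2 : (evD A (k + 1) (P * MvPolynomial.X i)).1 α =
        (evD A (k + 1) P).1 (Dk A (k + 1) (i + 1) α) := by
      rw [map_mul, ← h1]
      rfl
    have h3 : ((Dk A (k + 1) (i + 1) α : ⋀[A]^(k + 1) (XMod A)) : ExteriorAlgebra A (XMod A)) =
      D A (i + 1) α := rfl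
    rw [h2, hP, h3, detForm_shiftForm_D A k _ _ α.2, Dtilde_eq_T A (k + 1) _ (by omega), T_succ,
      mul_assoc]

end ShiftForm

/-! ### The ideal generated by the `D̃_m(T, p)` -/

section IdealMembership

variable {A : Type*} [CommRing A]

/-- This form matches the expansion of `p ε^j` in the basis. The two ranges of summation differ only
in terms with `c_i = 0` or with `D̃` at a negative index. -/
theorem DtildeP_eq_sum (k : ℕ) (p : A[X]) (hp : p.Monic) (m : ℤ) :
    DtildeP k p m = ∑ i ∈ Finset.range (p.natDegree + 1),
      p.coeff i • Dtilde A k (m - p.natDegree + i) := by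
  rw [Finset.sum_range_succ, hp.coeff_natDegree, one_smul, sub_add_cancel, add_comm, DtildeP]
  congr 1
  have h1 : ∑ i ∈ Finset.Icc 1 m.toNat, coeffC p i • Dtilde A k (m - i) =
      ∑ i ∈ Finset.Icc 1 (max m.toNat p.natDegree), coeffC p i • Dtilde A k (m - i) := by
    refine Finset.sum_subset (Finset.Icc_subset_Icc_right (le_max_left _ _)) fun i hi hi' => ?_
    simp only [Finset.mem_Icc] at hi hi'
    rw [Dtilde_of_neg _ _ _ (by omega), smul_zero]
  have h2 : ∑ i ∈ Finset.Icc 1 p.natDegree, coeffC p i • Dtilde A k (m - i) =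
      ∑ i ∈ Finset.Icc 1 (max m.toNat p.natDegree), coeffC p i • Dtilde A k (m - i) := by
    refine Finset.sum_subset (Finset.Icc_subset_Icc_right (le_max_right _ _)) fun i hi hi' => ?_
    simp only [Finset.mem_Icc] at hi hi'
    rw [coeffC, if_neg (by omega), zero_smul]
  rw [h1, ← h2]
  refine Finset.sum_nbij' (fun i => p.natDegree - i) (fun i => p.natDegree - i) ?_ ?_ ?_ ?_ ?_
  · intro i hi
    simp only [Finset.mem_Icc, Finset.mem_range] at hi ⊢
    omega
  · intro i hi
    simp only [Finset.mem_Icc, Finset.mem_range] at hi ⊢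
    omega
  · intro i hi
    simp only [Finset.mem_Icc] at hi
    omega
  · intro i hi
    simp only [Finset.mem_range] at hi
    omega
  · intro i hi
    simp only [Finset.mem_Icc] at hi
    rw [coeffC, if_pos hi.2]
    congr 2
    omega

/-- For `m > n` all the indices `m - n + i` are positive, so the recurrence for `D̃` holds term by
term. -/
theorem DtildeP_recurrence (k : ℕ) (p : A[X]) (hp : p.Monic) (m : ℤ) (hm : p.natDegree < m) :
    DtildeP k p m = -∑ r ∈ Finset.range k,
      PowerSeries.coeff (r + 1) (denom A k) * DtildeP k p (m - (r + 1)) := by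
  simp only [DtildeP_eq_sum k p hp, Finset.mul_sum]
  rw [Finset.sum_comm, ← Finset.sum_neg_distrib]
  refine Finset.sum_congr rfl fun i _ => ?_
  rw [Dtilde_recurrence A k _ (by omega), smul_neg, Finset.smul_sum]
  congr 1
  refine Finset.sum_congr rfl fun r _ => ?_
  rw [mul_smul_comm]
  congr 3
  ring

theorem DtildeP_mem_of_le (k : ℕ) (p : A[X]) (hp : p.Monic) (I : Ideal (MvPolynomial (Fin k) A))
    (hI : ∀ j : ℕ, 1 ≤ j → j ≤ k → DtildeP k p ((p.natDegree : ℤ) - k + j) ∈ I) (m : ℤ)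
    (hm : (p.natDegree : ℤ) - k + 1 ≤ m) : DtildeP k p m ∈ I := by
  obtain ⟨q, rfl⟩ := Int.le.dest hm
  induction q using Nat.strong_induction_on with
  | _ q ih =>
    by_cases hq : q < k
    · have := hI (q + 1) (by omega) (by omega)
      rw [Nat.cast_add, Nat.cast_one, add_comm (q : ℤ), ← add_assoc] at this
      exact this
    · rw [DtildeP_recurrence k p hp _ (by omega)]
      refine I.neg_mem (I.sum_mem fun r hr => I.mul_mem_left _ ?_)
      have hr := Finset.mem_range.1 hr
      have := ih (q - (r + 1)) (by omega) (by omega)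
      convert this using 2
      omega

/-- On `p` times `eps A j` the form takes the value `D̃_{n+j-a}(T, p)`, and `a ≤ k - 1` makes the
index at least `n - k + 1`. -/
theorem shiftForm_mulEnd_mem (k : ℕ) (p : A[X]) (hp : p.Monic)
    (I : Ideal (MvPolynomial (Fin k) A))
    (hI : ∀ j : ℕ, 1 ≤ j → j ≤ k → DtildeP k p ((p.natDegree : ℤ) - k + j) ∈ I)
    (a : ℕ) (ha : a < k) (m : XMod A) : shiftForm A k a (mulEnd p m) ∈ I := by
  -- Modulo `I` the claim is the vanishing of a linear map, which can be tested on the basis.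
  have : (I.restrictScalars A).mkQ ∘ₗ shiftForm A k a ∘ₗ mulEnd p = 0 := by
    refine XMod.linearMap_ext fun j => ?_
    rw [LinearMap.zero_apply, LinearMap.comp_apply, LinearMap.comp_apply, Submodule.mkQ_apply,
      Submodule.Quotient.mk_eq_zero, Submodule.restrictScalars_mem, mulEnd_eps_eq_sum, map_sum]
    have h1 := DtildeP_mem_of_le k p hp I hI ((p.natDegree : ℤ) + j - a) (by omega)
    rw [DtildeP_eq_sum k p hp] at h1
    convert h1 using 2 with i
    rw [map_smul, shiftForm_eps]
    congr 2
    push_cast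
    ring
  have h2 := LinearMap.congr_fun this m
  rwa [LinearMap.zero_apply, LinearMap.comp_apply, LinearMap.comp_apply, Submodule.mkQ_apply,
    Submodule.Quotient.mk_eq_zero] at h2

theorem detForm_shiftForm_mem (k : ℕ) (p : A[X]) (hp : p.Monic)
    (I : Ideal (MvPolynomial (Fin (k + 1)) A))
    (hI : ∀ j : ℕ, 1 ≤ j → j ≤ k + 1 →
      DtildeP (k + 1) p ((p.natDegree : ℤ) - (k + 1 : ℕ) + j) ∈ I)
    (α : ExteriorAlgebra A (XMod A)) (hα : α ∈ wedgeP (k + 1) p) :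
    detForm (shiftForm A (k + 1)) α ∈ I := by
  rw [wedgeP, Nat.add_sub_cancel] at hα
  induction hα using Submodule.mul_induction_on' with
  | mem_mul_mem a ha b hb =>
    obtain ⟨_, ⟨m, rfl⟩, rfl⟩ := hb
    rw [← ExteriorAlgebra.ιMulti_span_fixedDegree] at ha
    induction ha using Submodule.span_induction with
    | mem x hx =>
      obtain ⟨f, rfl⟩ := hx
      rw [ιMulti_mul_ι, detForm_ιMulti, Matrix.det_succ_row _ (Fin.last k)]
      refine I.sum_mem fun a _ => I.mul_mem_right _ (I.mul_mem_left _ ?_)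
      rw [Matrix.of_apply, Fin.snoc_last]
      exact shiftForm_mulEnd_mem (k + 1) p hp I hI a a.2 m
    | zero => simp
    | add x y _ _ hx hy =>
      rw [add_mul, map_add]
      exact I.add_mem hx hy
    | smul c x _ hx =>
      rw [smul_mul_assoc, map_smul, Algebra.smul_def]
      exact I.mul_mem_left _ hx
  | add a _ b _ ha hb =>
    rw [map_add]
    exact I.add_mem ha hb

end IdealMembership

/-! ### The inverse of `D_t` -/

section InverseDerivation

variable {A : Type*} [CommRing A] {M : Type*} [AddCommGroup M] [Module A M]

open Finset.HasAntidiagonal in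
-- Both sides run over the quadruples with sum `m`; this regroups the Leibniz expansion of a
-- composite of two derivations.
theorem sum_antidiagonal_interchange {B : Type*} [AddCommMonoid B] (F : ℕ → ℕ → ℕ → ℕ → B)
    (m : ℕ) :
    ∑ x ∈ antidiagonal m, ∑ y ∈ antidiagonal x.2, ∑ z ∈ antidiagonal x.1, F z.1 y.1 z.2 y.2 =
      ∑ x ∈ antidiagonal m, ∑ y ∈ antidiagonal x.1, ∑ z ∈ antidiagonal x.2,
        F y.1 y.2 z.1 z.2 := by
  simp only [Finset.sum_sigma']
  refine Finset.sum_bij'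
    (fun w _ => ⟨(w.2.2.1 + w.2.1.1, w.2.2.2 + w.2.1.2), (w.2.2.1, w.2.1.1), (w.2.2.2, w.2.1.2)⟩)
    (fun w _ => ⟨(w.2.1.1 + w.2.2.1, w.2.1.2 + w.2.2.2), (w.2.1.2, w.2.2.2), (w.2.1.1, w.2.2.1)⟩)
    ?_ ?_ ?_ ?_ ?_
  · rintro ⟨⟨a, b⟩, ⟨c, d⟩, ⟨e, f⟩⟩ h
    simp only [Finset.mem_sigma, mem_antidiagonal, and_self, and_true] at h ⊢
    omega
  · rintro ⟨⟨a, b⟩, ⟨c, d⟩, ⟨e, f⟩⟩ h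
    simp only [Finset.mem_sigma, mem_antidiagonal, and_self, and_true] at h ⊢
    omega
  · rintro ⟨⟨a, b⟩, ⟨c, d⟩, ⟨e, f⟩⟩ h
    simp only [Finset.mem_sigma, mem_antidiagonal] at h
    obtain ⟨-, rfl, rfl⟩ := h
    rfl
  · rintro ⟨⟨a, b⟩, ⟨c, d⟩, ⟨e, f⟩⟩ h
    simp only [Finset.mem_sigma, mem_antidiagonal] at h
    obtain ⟨-, rfl, rfl⟩ := h
    rfl
  · intros
    rfl

/-- The sequence `1, -g, 0, 0, …`, inverse to the sequence of the powers of `g`. -/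
def invPowers (g : Module.End A M) (i : ℕ) : Module.End A M :=
  if i = 0 then 1 else if i = 1 then -g else 0

open Finset.HasAntidiagonal in
-- The composite is multiplicative, so the identity reduces to `(1 - g t) ∑ g^i t^i = 1` on `M`.
theorem sum_derivCoeff_invPowers (g : Module.End A M) (m : ℕ) (α : ExteriorAlgebra A M) :
    ∑ x ∈ antidiagonal m,
      derivCoeff (invPowers g) x.1 (derivCoeff (fun i => g ^ i) x.2 α) =
        if m = 0 then α else 0 := by
  induction α using ExteriorAlgebra.induction generalizing m with
  | algebraMap a =>
    have : ∀ x ∈ antidiagonal m, derivCoeff (invPowers g) x.1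
        (derivCoeff (fun i => g ^ i) x.2 (algebraMap A (ExteriorAlgebra A M) a)) =
        if x = (0, 0) then algebraMap A (ExteriorAlgebra A M) a else 0 := by
      rintro ⟨i, j⟩ _
      rw [derivCoeff_algebraMap]
      split_ifs with h1 h2 h2 <;> simp_all [derivCoeff_algebraMap]
    rw [Finset.sum_congr rfl this, Finset.sum_ite_eq']
    simp [eq_comm]
  | ι v =>
    simp only [derivCoeff_ι, ← map_sum]
    cases m with
    | zero => simp [invPowers]
    | succ m =>
      rw [Finset.Nat.sum_antidiagonal_succ]
      cases m with
      | zero => simp [invPowers]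
      | succ m =>
        rw [Finset.Nat.sum_antidiagonal_succ]
        simp [invPowers, pow_succ']
  | mul a b ha hb =>
    simp only [derivCoeff_mul, map_sum]
    rw [sum_antidiagonal_interchange (fun i j i' j' =>
      derivCoeff (invPowers g) i (derivCoeff (fun i => g ^ i) j a) *
        derivCoeff (invPowers g) i' (derivCoeff (fun i => g ^ i) j' b))]
    simp only [← Finset.sum_mul_sum, ha, hb]
    have : ∀ x ∈ antidiagonal m, ((if x.1 = 0 then a else 0) * if x.2 = 0 then b else 0) =
        if x = (0, 0) then a * b else 0 := by
      rintro ⟨i, j⟩ _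
      simp only [Prod.mk.injEq]
      split_ifs <;> simp_all
    rw [Finset.sum_congr rfl this, Finset.sum_ite_eq']
    simp [eq_comm]
  | add a b ha hb =>
    simp only [map_add, Finset.sum_add_distrib, ha, hb]
    split_ifs <;> simp

theorem derivCoeff_zero_apply (f : ℕ → Module.End A M) (hf : f 0 = 1) (α : ExteriorAlgebra A M) :
    derivCoeff f 0 α = α := by
  induction α using ExteriorAlgebra.induction with
  | algebraMap a => simp [derivCoeff_algebraMap]
  | ι m => simp [derivCoeff_ι, hf]
  | mul a b ha hb => simp [derivCoeff_mul, ha, hb]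
  | add a b ha hb => rw [map_add, ha, hb]

/-- Each of the `k` factors of a wedge contributes degree at most `1` in `t`. -/
theorem derivCoeff_eq_zero_of_gt (f : ℕ → Module.End A M) (hf : ∀ i, 1 < i → f i = 0) (k h : ℕ)
    (hh : k < h) (α : ExteriorAlgebra A M) (hα : α ∈ ⋀[A]^k M) : derivCoeff f h α = 0 := by
  induction k generalizing h α with
  | zero =>
    rw [ExteriorAlgebra.exteriorPower, pow_zero] at hα
    obtain ⟨a, rfl⟩ := Submodule.mem_one.1 hα
    rw [derivCoeff_algebraMap, if_neg (by omega)]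
  | succ k ih =>
    rw [ExteriorAlgebra.exteriorPower, pow_succ] at hα
    induction hα using Submodule.mul_induction_on' with
    | mem_mul_mem a ha b hb =>
      rw [derivCoeff_mul]
      refine Finset.sum_eq_zero fun x hx => ?_
      have hx := Finset.HasAntidiagonal.mem_antidiagonal.1 hx
      obtain ⟨m, rfl⟩ := hb
      by_cases h1 : k < x.1
      · rw [ih _ h1 _ ha, zero_mul]
      · rw [derivCoeff_ι, hf _ (by omega), LinearMap.zero_apply, map_zero, mul_zero]
    | add a _ b _ ha hb => rw [map_add, ha, hb, add_zero]

end InverseDerivation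

/-! ### Evaluation at the operators and conclusion -/

section Evaluation

variable (A : Type*) [CommRing A]

/-- The restriction to `⋀^k M` of the `h`-th coefficient of the inverse of `D_t`. -/
noncomputable def invDk (k h : ℕ) : Module.End A (⋀[A]^k (XMod A)) :=
  (derivCoeff (invPowers (mulEnd (X : A[X]))) h).restrict fun α hα => derivCoeff_mem _ k h α hα

theorem mk_invDk_mul_mk_Dk (k : ℕ) :
    PowerSeries.mk (invDk A k) * PowerSeries.mk (Dk A k) = 1 := by
  ext1 m
  refine LinearMap.ext fun α => Subtype.ext ?_
  have h1 := sum_derivCoeff_invPowers (mulEnd (X : A[X])) m α.1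
  simp only [← D_eq] at h1
  rw [PowerSeries.coeff_mul, LinearMap.sum_apply, AddSubmonoidClass.coe_finsetSum,
    PowerSeries.coeff_one]
  simp only [PowerSeries.coeff_mk]
  refine Eq.trans h1 ?_
  split_ifs <;> rfl

/-- `P ↦ P(D)` as a ring homomorphism to `End_A(⋀^k M)`. -/
noncomputable def evEnd (k : ℕ) : MvPolynomial (Fin k) A →+* Module.End A (⋀[A]^k (XMod A)) where
  toFun P := (evD A k P).1
  map_one' := by rw [map_one]; rfl
  map_mul' P Q := by rw [map_mul]; rfl
  map_zero' := by rw [map_zero]; rfl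
  map_add' P Q := by rw [map_add]; rfl

theorem evEnd_apply (k : ℕ) (P : MvPolynomial (Fin k) A) : evEnd A k P = (evD A k P).1 := rfl

theorem Dk_zero (k : ℕ) : Dk A k 0 = 1 := by
  refine LinearMap.ext fun α => Subtype.ext ?_
  exact derivCoeff_zero_apply _ (by simp [mulEnd]) α.1

theorem evEnd_T (k m : ℕ) (hm : m ≤ k) : evEnd A k (T A k m) = Dk A k m := by
  cases m with
  | zero => rw [Nat.cast_zero, T_zero, map_one, Dk_zero]
  | succ m =>
    rw [T_succ A k ⟨m, hm⟩, evEnd_apply]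
    simp [evD]

variable {A} in
/-- A ring homomorphism sending `T_i` to `D_i` for `i ≤ k` sends `D̃_m` to `D_m` for all `m`, provided
that the series `∑ D_m t^m` is invertible with inverse a polynomial of degree at most `k`. -/
theorem map_Dtilde {B : Type*} [Semiring B] (k : ℕ) (φ : MvPolynomial (Fin k) A →+* B) (d e : ℕ → B)
    (hed : PowerSeries.mk e * PowerSeries.mk d = 1) (he : ∀ r, k < r → e r = 0)
    (hd : ∀ i ≤ k, φ (T A k i) = d i) (m : ℕ) : φ (Dtilde A k m) = d m := by
  obtain ⟨ψ, hψ⟩ := exists_mk_T_mul_eq_one A k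
  have h1 := congrArg (PowerSeries.map φ) hψ
  rw [map_mul, map_one] at h1
  -- Up to order `k` both sides are inverses of series that agree to that order; beyond `k` both
  -- vanish.
  have h2 : PowerSeries.map φ (denom A k) = PowerSeries.mk e := by
    ext1 r
    rw [PowerSeries.coeff_map]
    by_cases hr : r ≤ k
    · rw [coeff_denom_of_le A k r hr ψ hψ, ← PowerSeries.coeff_map]
      refine (coeff_inv_congr (k := k) hed h1 (fun i hi => ?_) r hr).symm
      rw [PowerSeries.coeff_map, PowerSeries.coeff_mk, PowerSeries.coeff_mk, hd i hi]
    · rw [coeff_denom_of_gt A k r (by omega), map_zero, PowerSeries.coeff_mk, he r (by omega)]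
  -- `B` need not be commutative, so the factors are swapped before applying `φ`: this gives a left
  -- inverse of `∑ e_r t^r`, to be compared with the right inverse `∑ d_m t^m`.
  have h3 := congrArg (PowerSeries.map φ) ((mul_comm _ _).trans (denom_mul_mk_Dtilde A k))
  rw [map_mul, map_one, h2] at h3
  have h4 := left_inv_eq_right_inv h3 hed
  simpa using congrArg (PowerSeries.coeff m) h4

/-- The operator `D_m` on `⋀^k M` is the value of the polynomial `D̃_m` at `D_1, …, D_k`. -/
theorem evEnd_Dtilde (k m : ℕ) : evEnd A k (Dtilde A k m) = Dk A k m := by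
  refine map_Dtilde k (evEnd A k) (Dk A k) (invDk A k) (mk_invDk_mul_mk_Dk A k) (fun r hr => ?_)
    (evEnd_T A k) m
  refine LinearMap.ext fun α => Subtype.ext ?_
  refine derivCoeff_eq_zero_of_gt _ (fun i hi => ?_) k r hr α.1 α.2
  rw [invPowers, if_neg (by omega), if_neg (by omega)]

/-- For `q < k` both sides vanish: the left has a negative index, the right a repeated vector.
Covering these `q` is what allows `n` to be smaller than the exterior degree. -/
theorem evEnd_Dtilde_epsTop (k q : ℕ) :
    ((evEnd A (k + 1) (Dtilde A (k + 1) ((q : ℤ) - k)) (epsTop A (k + 1)) :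
      ⋀[A]^(k + 1) (XMod A)) : ExteriorAlgebra A (XMod A)) =
      ExteriorAlgebra.ιMulti A k (fun b : Fin k => eps A b) *
        ExteriorAlgebra.ι A (eps A q) := by
  by_cases hq : k ≤ q
  · obtain ⟨h, rfl⟩ := Nat.exists_eq_add_of_le hq
    rw [show ((k + h : ℕ) : ℤ) - k = h by push_cast; ring, evEnd_Dtilde]
    exact D_ιMulti_eps A k h
  · rw [Dtilde_of_neg _ _ _ (by omega), map_zero, ιMulti_mul_ι]
    refine ((ExteriorAlgebra.ιMulti A (k + 1)).map_eq_zero_of_eq _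
      (i := Fin.castSucc ⟨q, by omega⟩) (j := Fin.last k) ?_ ?_).symm
    · rw [Fin.snoc_castSucc, Fin.snoc_last]
    · exact (Fin.castSucc_lt_last _).ne

theorem evD_surjective (k : ℕ) : Function.Surjective (evD A k) := by
  rintro ⟨x, hx⟩
  suffices h : ∃ P, evEnd A k P = x by
    obtain ⟨P, hP⟩ := h
    exact ⟨P, Subtype.ext hP⟩
  induction hx using Algebra.adjoin_induction with
  | mem x hx =>
    obtain ⟨i, rfl⟩ := hx
    exact ⟨MvPolynomial.X i, by simp [evEnd_apply, evD]⟩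
  | algebraMap a => exact ⟨algebraMap A _ a, by rw [evEnd_apply, AlgHom.commutes]; rfl⟩
  | add x y _ _ hx hy =>
    obtain ⟨P, rfl⟩ := hx
    obtain ⟨Q, rfl⟩ := hy
    exact ⟨P + Q, map_add _ _ _⟩
  | mul x y _ _ hx hy =>
    obtain ⟨P, rfl⟩ := hx
    obtain ⟨Q, rfl⟩ := hy
    exact ⟨P * Q, map_mul _ _ _⟩

variable {A}

theorem evD_DtildeP_mem_J (k : ℕ) (p : A[X]) (hp : p.Monic) (j : ℕ) :
    evD A (k + 1) (DtildeP (k + 1) p ((p.natDegree : ℤ) - (k + 1 : ℕ) + (j + 1 : ℕ))) ∈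
      J (k + 1) p := by
  change ((evEnd A (k + 1) (DtildeP (k + 1) p _) (epsTop A (k + 1)) :
    ⋀[A]^(k + 1) (XMod A)) : ExteriorAlgebra A (XMod A)) ∈ wedgeP (k + 1) p
  have hsmul : ∀ (c : A) (P : MvPolynomial (Fin (k + 1)) A),
      evEnd A (k + 1) (c • P) = c • evEnd A (k + 1) P := fun c P => by
    rw [evEnd_apply, map_smul]
    rfl
  have h1 : ((evEnd A (k + 1) (DtildeP (k + 1) p
      ((p.natDegree : ℤ) - (k + 1 : ℕ) + (j + 1 : ℕ))) (epsTop A (k + 1)) :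
      ⋀[A]^(k + 1) (XMod A)) : ExteriorAlgebra A (XMod A)) =
      ExteriorAlgebra.ιMulti A k (fun b : Fin k => eps A b) *
        ExteriorAlgebra.ι A (mulEnd p (eps A j)) := by
    rw [DtildeP_eq_sum _ p hp, map_sum, LinearMap.sum_apply, AddSubmonoidClass.coe_finsetSum,
      mulEnd_eps_eq_sum, map_sum, Finset.mul_sum]
    refine Finset.sum_congr rfl fun i _ => ?_
    rw [hsmul, LinearMap.smul_apply, Submodule.coe_smul, map_smul, mul_smul_comm,
      ← evEnd_Dtilde_epsTop]
    congr 5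
    push_cast
    ring
  rw [h1, wedgeP, Nat.add_sub_cancel]
  exact Submodule.mul_mem_mul (ExteriorAlgebra.ιMulti_range A k (Set.mem_range_self _))
    (Submodule.mem_map_of_mem (LinearMap.mem_range_self _ _))

theorem comap_evD_J (k : ℕ) (p : A[X]) (hp : p.Monic) :
    (J (k + 1) p).comap (evD A (k + 1)) = Ideal.span {Q | ∃ j : ℕ, 1 ≤ j ∧ j ≤ k + 1 ∧
      Q = DtildeP (k + 1) p ((p.natDegree : ℤ) - (k + 1 : ℕ) + j)} := by
  apply le_antisymm
  · intro P hP
    -- The form takes the value `1` on the top wedge, so its value on `P(D)(ε^1 ∧ … ∧ ε^{k+1})` is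
    -- `P` itself.
    have h1 := detForm_shiftForm_evD A k P (epsTop A (k + 1))
    have h2 : detForm (shiftForm A (k + 1)) (epsTop A (k + 1) : ⋀[A]^(k + 1) (XMod A)) = 1 :=
      detForm_shiftForm_top A k
    rw [h2, mul_one] at h1
    rw [← h1]
    refine detForm_shiftForm_mem k p hp _ (fun j h1 h2 => ?_) _ hP
    exact Ideal.subset_span ⟨j, h1, h2, rfl⟩
  · rw [Ideal.span_le]
    rintro _ ⟨j, hj, -, rfl⟩
    obtain ⟨j, rfl⟩ := Nat.exists_eq_add_of_le' hj
    exact evD_DtildeP_mem_J k p hp j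

end Evaluation

end GrassmannAlgebra

theorem mainTheorem2 {A : Type*} [CommRing A] (p : Polynomial A) (hp : p.Monic) (n : ℕ)
    (hn : p.natDegree = n) (k : ℕ) (hk : 1 ≤ k) :
    GrassmannAlgebra.J k p =
        Ideal.span {x | ∃ j : ℕ, 1 ≤ j ∧ j ≤ k ∧
          x = GrassmannAlgebra.evD A k (GrassmannAlgebra.DtildeP k p ((n : ℤ) - k + j))} ∧
      (GrassmannAlgebra.J k p).comap (GrassmannAlgebra.evD A k) =
        Ideal.span {Q | ∃ j : ℕ, 1 ≤ j ∧ j ≤ k ∧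
          Q = GrassmannAlgebra.DtildeP k p ((n : ℤ) - k + j)} := by
  subst hn
  obtain ⟨k, rfl⟩ := Nat.exists_eq_add_of_le' hk
  have h := GrassmannAlgebra.comap_evD_J k p hp
  refine ⟨?_, h⟩
  -- Surjectivity of `P ↦ P(D)` makes `J` the image of its preimage, so its generators are the
  -- images of those found above.
  rw [← Ideal.map_comap_of_surjective _ (GrassmannAlgebra.evD_surjective A (k + 1))
    (GrassmannAlgebra.J (k + 1) p), h, Ideal.map_span]
  congr 1
  ext x
  constructor
  · rintro ⟨_, ⟨j, h1, h2, rfl⟩, rfl⟩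
    exact ⟨j, h1, h2, rfl⟩
  · rintro ⟨j, h1, h2, rfl⟩
    exact ⟨_, ⟨j, h1, h2, rfl⟩, rfl⟩
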